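/- Consider $n$ bidders, each wanting a single item out of a supply of identical items that arrive one at a time; bidder $i$ has a value $v_i\ge 0$ for an item. A deterministic mechanism collects all bids before any item arrives. Not knowing how many items will arrive, it decides when each item arrives, as a function of the bids and of the index of that item, whether to assign it to some bidder who has no item yet, and it simultaneously fixes the (real) price charged to that bidder. A bidder who receives an item at price $p$ has utility $v_i-p$; a bidder who receives none has utility $0$. The mechanism is truthful if, for every number $\ell$ of arriving items, every bidder and all bids of the other bidders, bidding one's true value maximizes one's utility. A truthful randomized mechanism is a probability distribution over deterministic truthful mechanisms. With adversarial supply, it achieves an $\alpha$-approximation to social welfare if for all values $v_1,\dots,v_n\ge 0$ and every $\ell\in\{1,\dots,n\}$, $$\mathrm{OPT}_\ell(v)\le \alpha\cdot \mathrm{E}[W_\ell(v)],$$ where $\mathrm{OPT}_\ell(v)$ is the sum of the $\ell$ largest values and $W_\ell(v)$ is the sum of the values of the bidders who have received an item after $\ell$ arrivals, when all bid truthfully. **Theorem 2.** With adversarial supply, no truthful randomized mechanism achieves an $o(\log\log n)$ approximation to social welfare. Precisely: there are absolute constants $c>0$ and $N$ such that for all $n\ge N$, if a truthful randomized mechanism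 for $n$ bidders achieves an $\alpha$-approximation, then $\alpha\ge c\log\log n$. In particular, if $(\mathcal M^{(n)})_n$ is a family of truthful randomized mechanisms, $\mathcal M^{(n)}$ for $n$ bidders, and $\mathcal M^{(n)}$ achieves an $\alpha(n)$-approximation for infinitely many $n$, then $\alpha(n)\ne o(\log\log n)$ as $n\to\infty$. -/

import Mathlib

open scoped NNReal

universe u

namespace OnlineSupply

/-- A deterministic mechanism with online supply for `n` bidders who each want a single item.
All bids (non-negative reals) are submitted before any item arrives. Items arrive one by one and
are numbered from `0`. The number of items that will arrive is not known to the mechanism, so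
who receives item `t`, and the price charged at that moment, depend on the bids and on `t` only. -/
structure DetMechanism (n : ℕ) where
  /-- `alloc b t` is the bidder who receives item `t` (if it arrives), or `none`. -/
  alloc : (Fin n → ℝ≥0) → ℕ → Option (Fin n)
  /-- `price b t` is the price charged to the recipient of item `t` when it is assigned. -/
  price : (Fin n → ℝ≥0) → ℕ → ℝ
  /-- No bidder is assigned more than one item. -/
  alloc_inj : ∀ b s t i, alloc b s = some i → alloc b t = some i → s = t

namespace DetMechanism

variable {n : ℕ} (M : DetMechanism n)

/-- The set of bidders holding an item after `ℓ` items have arrived. -/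
def winners (b : Fin n → ℝ≥0) (ℓ : ℕ) : Finset (Fin n) :=
  {i | ∃ t < ℓ, M.alloc b t = some i}

/-- The social welfare with valuations `v` (reported truthfully) when `ℓ` items arrive. -/
def welfare (v : Fin n → ℝ≥0) (ℓ : ℕ) : ℝ≥0 :=
  ∑ i ∈ M.winners v ℓ, v i

/-- The utility of bidder `i` with true value `x` when the reported bids are `b` and `ℓ` items
arrive: value minus price if `i` is among the first `ℓ` recipients, and `0` otherwise. The sum has
at most one nonzero term, since `i` receives at most one item. -/
noncomputable def utility (ℓ : ℕ) (i : Fin n) (x : ℝ≥0) (b : Fin n → ℝ≥0) : ℝ :=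
  ∑ t ∈ Finset.range ℓ, if M.alloc b t = some i then (x : ℝ) - M.price b t else 0

/-- Ex-post truthfulness: for every supply `ℓ`, every bidder `i` with true value `b i`, all bids of
the others and every alternative bid `x` of `i`, bidding truthfully is at least as good. -/
def Truthful : Prop :=
  ∀ (ℓ : ℕ) (i : Fin n) (b : Fin n → ℝ≥0) (x : ℝ≥0),
    M.utility ℓ i (b i) (Function.update b i x) ≤ M.utility ℓ i (b i) b

end DetMechanism

/-- The optimal social welfare `OPT_ℓ` when `ℓ` items arrive: the largest total value of at most
`ℓ` bidders, i.e. the sum of the `ℓ` highest values. -/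
noncomputable def optWelfare {n : ℕ} (v : Fin n → ℝ≥0) (ℓ : ℕ) : ℝ≥0 :=
  ({S | S.card ≤ ℓ} : Finset (Finset (Fin n))).sup fun S => ∑ i ∈ S, v i

/-- A randomized mechanism: a deterministic mechanism drawn at random, i.e. a family of
deterministic mechanisms indexed by a probability space of internal randomness, for which the
welfare at each valuation profile and supply is a random variable. -/
structure RandMechanism (n : ℕ) where
  Ω : Type u
  [mΩ : MeasurableSpace Ω]
  P : MeasureTheory.Measure Ω
  [isProb : MeasureTheory.IsProbabilityMeasure P]
  mech : Ω → DetMechanism n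
  measurable_welfare : ∀ (v : Fin n → ℝ≥0) (ℓ : ℕ), Measurable fun ω => (mech ω).welfare v ℓ

namespace RandMechanism

attribute [instance] RandMechanism.mΩ RandMechanism.isProb

variable {n : ℕ} (M : RandMechanism.{u} n)

/-- A randomized mechanism is truthful if it is a distribution over deterministic truthful
mechanisms. -/
def Truthful : Prop :=
  ∀ ω, (M.mech ω).Truthful

/-- The expected social welfare over the randomness of the mechanism. -/
noncomputable def expectedWelfare (v : Fin n → ℝ≥0) (ℓ : ℕ) : ℝ :=
  ∫ ω, ((M.mech ω).welfare v ℓ : ℝ) ∂M.P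

/-- `M` achieves an `α`-approximation to social welfare with adversarial supply: for all valuations
and every supply `1 ≤ ℓ ≤ n`, the ratio of `OPT_ℓ` to the expected welfare is at most `α`
(written without division). -/
def AchievesApprox (α : ℝ) : Prop :=
  ∀ (v : Fin n → ℝ≥0) (ℓ : ℕ), 1 ≤ ℓ → ℓ ≤ n →
    (optWelfare v ℓ : ℝ) ≤ α * M.expectedWelfare v ℓ

end RandMechanism

end OnlineSupply

namespace OnlineSupply

/-! ### Truthfulness and service times. -/

namespace DetMechanism

variable {n : ℕ} {M : DetMechanism n}

/-! By averaging (Yao's principle), it suffices to find a random profile on which every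
deterministic truthful mechanism does badly on average over many supplies. Draw independent uniform
types in `Fin n`. On average B^(2j) bidders have type below B^(2j), and these have value at least
B^(-j), so the optimum at supply B^(2j) averages at least B^j / 2
(`card_mul_half_le_sum_optWelfare`).

To compete at supply B^(2(j+1)), a mechanism must serve many bidders of type below B^(2(j+1)) within
phase j, between items B^(2j) and B^(2(j+1)): all other welfare averages at most 5 B^j
(`welfare_levelProfile_le`). But with the other bids fixed, a bidder's service time takes at most
three values as the own bid varies (`Truthful.exists_sign`), so the bidder can be served in at most
three phases. After division by B^(j+1), the phase contributions therefore total at most 3 over all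
j < K (`Truthful.sum_servedInPhase_le`).

So the normalized welfares sum to at most 5K/B + 3 ≤ 8 on average, the normalized optima to at least
K/2. Taking B = K gives α ≥ K/16 whenever K^(2K) ≤ n; K = ⌊log log n⌋ is far smaller than this
condition requires. -/

theorem utility_eq_of_alloc {ℓ t : ℕ} {i : Fin n} {b : Fin n → ℝ≥0} (x : ℝ≥0)
    (h : M.alloc b t = some i) (ht : t < ℓ) : M.utility ℓ i x b = x - M.price b t := by
  unfold utility
  rw [Finset.sum_eq_single t]
  · simp [h]
  · intro s _ hst
    rw [if_neg]
    exact fun hs => hst (M.alloc_inj b s t i hs h)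
  · intro h'
    exact absurd (Finset.mem_range.2 ht) h'

theorem utility_eq_zero {ℓ t : ℕ} {i : Fin n} {b : Fin n → ℝ≥0} (x : ℝ≥0)
    (h : M.alloc b t = some i) (ht : ℓ ≤ t) : M.utility ℓ i x b = 0 := by
  unfold utility
  refine Finset.sum_eq_zero fun s hs => if_neg fun h' => ?_
  have := M.alloc_inj b s t i h' h
  have := Finset.mem_range.1 hs
  omega

theorem Truthful.utility_update_le (hM : M.Truthful) (ℓ : ℕ) (i : Fin n) (b : Fin n → ℝ≥0)
    (x y : ℝ≥0) :
    M.utility ℓ i x (Function.update b i y) ≤ M.utility ℓ i x (Function.update b i x) := by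
  simpa using hM ℓ i (Function.update b i x) y

/-- The price a bidder pays when served does not depend on the bidder's own bid. -/
theorem Truthful.price_eq (hM : M.Truthful) {i : Fin n} {b : Fin n → ℝ≥0} {x y : ℝ≥0} {s t : ℕ}
    (hx : M.alloc (Function.update b i x) s = some i)
    (hy : M.alloc (Function.update b i y) t = some i) :
    M.price (Function.update b i x) s = M.price (Function.update b i y) t := by
  -- At this supply the bidder is served under both bids, so neither price may undercut the other.
  have hs : s < max s t + 1 := by omega
  have ht : t < max s t + 1 := by omega
  have h1 := hM.utility_update_le (max s t + 1) i b x y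
  have h2 := hM.utility_update_le (max s t + 1) i b y x
  rw [utility_eq_of_alloc _ hx hs, utility_eq_of_alloc _ hy ht] at h1 h2
  linarith

/-- Given the bids of the others, bidder `i` is served at no more than three different times as the
bidder's own bid varies: the time is determined by the comparison of the bid with the price. -/
theorem Truthful.exists_sign (hM : M.Truthful) (i : Fin n) (b : Fin n → ℝ≥0) :
    ∃ c : ℝ≥0 → SignType, ∀ x y s t, M.alloc (Function.update b i x) s = some i →
      M.alloc (Function.update b i y) t = some i → c x = c y → s = t := by
  by_cases hw : ∃ z r, M.alloc (Function.update b i z) r = some i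
  swap
  · exact ⟨fun _ => 0, fun x y s t hx => absurd ⟨x, s, hx⟩ hw⟩
  obtain ⟨z, r, hz⟩ := hw
  set p := M.price (Function.update b i z) r with hp
  refine ⟨fun x => SignType.sign ((x : ℝ) - p), ?_⟩
  have key : ∀ (x y : ℝ≥0) (s t : ℕ), M.alloc (Function.update b i x) s = some i →
      M.alloc (Function.update b i y) t = some i →
      SignType.sign ((x : ℝ) - p) = SignType.sign ((y : ℝ) - p) → t ≤ s := by
    -- If s < t, stop the supply right after item s: bid x wins and bid y does not, so y ≤ p ≤ x.
    -- Equal signs then force x = y = p, hence s = t.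
    intro x y s t hx hy hc
    by_contra! hlt
    have h1 := hM.utility_update_le (s + 1) i b x y
    have h2 := hM.utility_update_le (s + 1) i b y x
    rw [utility_eq_of_alloc _ hx (by omega), utility_eq_zero _ hy (by omega),
      hM.price_eq hx hz, ← hp] at h1 h2
    have hxy : x = y := by
      rcases h1.lt_or_eq with h | h
      · rw [sign_pos h, eq_comm, sign_eq_one_iff] at hc
        linarith
      · rw [← h, sign_zero, eq_comm, sign_eq_zero_iff] at hc
        exact NNReal.eq (by linarith)
    subst hxy
    exact hlt.ne (M.alloc_inj _ s t i hx hy)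
  exact fun x y s t hx hy hc => le_antisymm (key y x t s hy hx hc.symm) (key x y s t hx hy hc)

theorem mem_winners {b : Fin n → ℝ≥0} {ℓ : ℕ} {i : Fin n} :
    i ∈ M.winners b ℓ ↔ ∃ t < ℓ, M.alloc b t = some i := by
  simp [winners]

theorem card_winners_le (b : Fin n → ℝ≥0) (ℓ : ℕ) : (M.winners b ℓ).card ≤ ℓ := by
  have h : ∀ i ∈ M.winners b ℓ, ∃ t < ℓ, M.alloc b t = some i := fun i hi => mem_winners.1 hi
  choose! τ hτ hτ' using h
  have := Finset.card_le_card_of_injOn (s := M.winners b ℓ) (t := Finset.range ℓ) τ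
    (fun i hi => Finset.mem_coe.2 (Finset.mem_range.2 (hτ i hi))) (fun i hi j hj hij => by
      have h1 := hτ' i hi
      have h2 := hτ' j hj
      rw [hij, h2] at h1
      exact (Option.some.inj h1).symm)
  simpa using this

theorem welfare_le_sum (v : Fin n → ℝ≥0) (ℓ : ℕ) : M.welfare v ℓ ≤ ∑ i, v i :=
  Finset.sum_le_univ_sum_of_nonneg fun _ => zero_le

end DetMechanism

/-! ### Integrability of the welfare and a lower bound on the optimum. -/

theorem RandMechanism.integrable_welfare {n : ℕ} (M : RandMechanism.{u} n) (v : Fin n → ℝ≥0)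
    (ℓ : ℕ) : MeasureTheory.Integrable (fun ω => ((M.mech ω).welfare v ℓ : ℝ)) M.P := by
  refine MeasureTheory.Integrable.of_bound (C := ((∑ i, v i : ℝ≥0) : ℝ))
    (M.measurable_welfare v ℓ).coe_nnreal_real.aestronglyMeasurable
    (Filter.Eventually.of_forall fun ω => ?_)
  rw [Real.norm_of_nonneg (NNReal.coe_nonneg _)]
  exact NNReal.coe_le_coe.2 (DetMechanism.welfare_le_sum v ℓ)

theorem mul_min_card_le_optWelfare {n : ℕ} (v : Fin n → ℝ≥0) (ℓ : ℕ) (a : ℝ≥0)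
    (S : Finset (Fin n)) (hS : ∀ i ∈ S, a ≤ v i) :
    a * (min S.card ℓ : ℕ) ≤ optWelfare v ℓ := by
  obtain ⟨T, hTS, hT⟩ := Finset.exists_subset_card_eq (min_le_left S.card ℓ)
  have h1 : a * (min S.card ℓ : ℕ) ≤ ∑ i ∈ T, v i := by
    rw [← hT, mul_comm, ← nsmul_eq_mul]
    exact Finset.card_nsmul_le_sum _ _ _ fun i hi => hS i (hTS hi)
  refine h1.trans ?_
  unfold optWelfare
  exact Finset.le_sup (f := fun S => ∑ i ∈ S, v i) (by simp [hT])

/-! ### Moments of independent uniform types. -/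

section Averaging

variable {ι κ : Type*} [Fintype ι] [DecidableEq ι] [Fintype κ]

/-- Resampling one coordinate does not change the average over all functions. -/
theorem sum_sum_update (F : (ι → κ) → ℝ) (i : ι) :
    ∑ f, ∑ r, F (Function.update f i r) = Fintype.card κ * ∑ f, F f := by
  have h : ∑ p : (ι → κ) × κ, F (Function.update p.1 i p.2) = ∑ p : (ι → κ) × κ, F p.1 :=
    -- Swapping coordinate i with the fresh sample is an involution.
    Finset.sum_nbij' (fun p => (Function.update p.1 i p.2, p.1 i))
      (fun p => (Function.update p.1 i p.2, p.1 i)) (by simp) (by simp) (by simp) (by simp)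
      (by simp)
  rw [Fintype.sum_prod_type, Fintype.sum_prod_type] at h
  simpa [Finset.mul_sum] using h

theorem card_mul_sum_apply (g : κ → ℝ) (i : ι) :
    Fintype.card κ * ∑ f : ι → κ, g (f i) = Fintype.card (ι → κ) * ∑ r, g r := by
  rw [← sum_sum_update _ i]
  simp

theorem card_mul_sum_apply_mul_apply (g : κ → ℝ) {i k : ι} (hik : i ≠ k) :
    (Fintype.card κ : ℝ) ^ 2 * ∑ f : ι → κ, g (f i) * g (f k)
      = Fintype.card (ι → κ) * (∑ r, g r) ^ 2 := by
  rw [pow_two, mul_assoc, ← sum_sum_update _ i]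
  simp only [Function.update_self, Function.update_of_ne hik.symm, ← Finset.sum_mul]
  rw [← Finset.mul_sum, mul_left_comm, card_mul_sum_apply]
  ring

end Averaging

/-- The number of bidders whose type is below `m`. -/
def countBelow {n : ℕ} (f : Fin n → Fin n) (m : ℕ) : ℝ :=
  ∑ i, if (f i : ℕ) < m then 1 else 0

theorem sum_ite_val_lt {n m : ℕ} (hm : m ≤ n) :
    ∑ r : Fin n, (if (r : ℕ) < m then (1 : ℝ) else 0) = m := by
  rw [Finset.sum_boole, Fin.card_filter_val_lt, min_eq_right hm]

theorem sum_countBelow {n m : ℕ} (hn : 0 < n) (hm : m ≤ n) :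
    ∑ f : Fin n → Fin n, countBelow f m = Fintype.card (Fin n → Fin n) * m := by
  have hn' : (0 : ℝ) < n := by exact_mod_cast hn
  unfold countBelow
  rw [Finset.sum_comm]
  have h : ∀ i : Fin n, ∑ f : Fin n → Fin n, (if (f i : ℕ) < m then (1 : ℝ) else 0)
      = Fintype.card (Fin n → Fin n) * m / n := by
    intro i
    have := card_mul_sum_apply (fun r : Fin n => if (r : ℕ) < m then (1 : ℝ) else 0) i
    rw [sum_ite_val_lt hm, Fintype.card_fin] at this
    rw [eq_div_iff hn'.ne', ← this, mul_comm]
  simp only [h, Finset.sum_const, Finset.card_univ, Fintype.card_fin, nsmul_eq_mul]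
  field_simp

/-- Distinct coordinates are independent: the pairs i ≠ k contribute at most m² on average, the
diagonal m. -/
theorem sum_countBelow_sq_le {n m : ℕ} (hn : 0 < n) (hm : m ≤ n) :
    ∑ f : Fin n → Fin n, countBelow f m ^ 2
      ≤ Fintype.card (Fin n → Fin n) * (m + (m : ℝ) ^ 2) := by
  have hn' : (0 : ℝ) < n := by exact_mod_cast hn
  set C : ℝ := ((Fintype.card (Fin n → Fin n) : ℕ) : ℝ) with hC
  have hC0 : 0 ≤ C := by positivity
  set g : Fin n → ℝ := fun r => if (r : ℕ) < m then 1 else 0 with hg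
  have hgs : ∑ r, g r = m := sum_ite_val_lt hm
  have h1 : ∀ i k : Fin n, ∑ f : Fin n → Fin n, g (f i) * g (f k)
      ≤ (if i = k then C * m / n else 0) + C * m ^ 2 / n ^ 2 := by
    intro i k
    split_ifs with hik
    · subst hik
      have h2 : ∀ r, g r * g r = g r := fun r => by simp [hg]
      have h3 := card_mul_sum_apply g i
      rw [hgs, Fintype.card_fin] at h3
      have h4 : ∑ f : Fin n → Fin n, g (f i) * g (f i) = C * m / n := by
        simp only [h2]
        rw [eq_div_iff hn'.ne', ← h3, mul_comm]
      rw [h4]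
      exact le_add_of_nonneg_right (by positivity)
    · have h3 := card_mul_sum_apply_mul_apply g hik
      rw [hgs, Fintype.card_fin] at h3
      rw [zero_add, le_div_iff₀ (by positivity), ← h3, mul_comm]
  calc ∑ f : Fin n → Fin n, countBelow f m ^ 2
      = ∑ f : Fin n → Fin n, ∑ i, ∑ k, g (f i) * g (f k) := by
        refine Finset.sum_congr rfl fun f _ => ?_
        rw [pow_two, countBelow, Finset.sum_mul_sum]
    _ = ∑ i, ∑ k, ∑ f : Fin n → Fin n, g (f i) * g (f k) := by
        rw [Finset.sum_comm]
        exact Finset.sum_congr rfl fun i _ => Finset.sum_comm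
    _ ≤ ∑ i : Fin n, ∑ k : Fin n, ((if i = k then C * m / n else 0) + C * m ^ 2 / n ^ 2) :=
        Finset.sum_le_sum fun i _ => Finset.sum_le_sum fun k _ => h1 i k
    _ = C * (m + (m : ℝ) ^ 2) := by
        simp only [Finset.sum_add_distrib, Finset.sum_ite_eq, Finset.mem_univ, if_true,
          Finset.sum_const, Finset.card_univ, Fintype.card_fin, nsmul_eq_mul]
        field_simp

/-- A second moment argument: min(X, m) ≥ X - X²/(4m), where the bound by m is (X - 2m)² ≥ 0. Since
E X = m and E X² ≤ m + m² ≤ 2m², the average is at least m/2. -/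
theorem card_mul_half_le_sum_min_countBelow {n m : ℕ} (hn : 0 < n) (hm : m ≤ n) (hm' : 0 < m) :
    Fintype.card (Fin n → Fin n) * ((m : ℝ) / 2)
      ≤ ∑ f : Fin n → Fin n, min (countBelow f m) m := by
  have hm0 : (1 : ℝ) ≤ m := by exact_mod_cast hm'
  set C : ℝ := ((Fintype.card (Fin n → Fin n) : ℕ) : ℝ) with hC
  have hC0 : 0 ≤ C := by positivity
  have h1 : ∀ f : Fin n → Fin n,
      countBelow f m - countBelow f m ^ 2 / (4 * m) ≤ min (countBelow f m) m := by
    intro f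
    refine le_min (sub_le_self _ (by positivity)) ?_
    rw [sub_le_iff_le_add, ← sub_le_iff_le_add', le_div_iff₀ (by positivity)]
    nlinarith [sq_nonneg (countBelow f m - 2 * m)]
  refine le_trans ?_ (Finset.sum_le_sum fun f _ => h1 f)
  rw [Finset.sum_sub_distrib, ← Finset.sum_div, sum_countBelow hn hm]
  have h2 := sum_countBelow_sq_le hn hm
  have h3 : (∑ f : Fin n → Fin n, countBelow f m ^ 2) / (4 * m) ≤ C * (m / 2) := by
    rw [div_le_iff₀ (by positivity)]
    refine h2.trans ?_
    rw [mul_assoc]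
    refine mul_le_mul_of_nonneg_left ?_ hC0
    nlinarith
  rw [← hC]
  linarith

/-! ### The hard distribution and the welfare of a deterministic truthful mechanism. -/

/-- A bidder of type `r` gains value `B⁻ʲ` at every level `j ≤ K` with `r < B ^ (2 * j)`. -/
noncomputable def levelValue (B K r : ℕ) : ℝ≥0 :=
  ∑ j ∈ Finset.range (K + 1), if r < B ^ (2 * j) then (B : ℝ≥0)⁻¹ ^ j else 0

/-- The valuation profile given by a profile of types. -/
noncomputable def levelProfile (B K : ℕ) {n : ℕ} (f : Fin n → Fin n) : Fin n → ℝ≥0 :=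
  fun i => levelValue B K (f i)

theorem levelProfile_update (B K : ℕ) {n : ℕ} (f : Fin n → Fin n) (i r : Fin n) :
    levelProfile B K (Function.update f i r)
      = Function.update (levelProfile B K f) i (levelValue B K r) := by
  ext k
  by_cases h : k = i
  · subst h; simp [levelProfile]
  · simp [levelProfile, h]

theorem sum_inv_pow_Ico_le {B : ℕ} (hB : 2 ≤ B) (m k : ℕ) :
    ∑ j ∈ Finset.Ico m k, ((B : ℝ)⁻¹) ^ j ≤ 2 * (B : ℝ)⁻¹ ^ m := by
  have hB' : (2 : ℝ) ≤ B := by exact_mod_cast hB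
  have h0 : (0 : ℝ) < (B : ℝ)⁻¹ := by positivity
  have h1 : (B : ℝ)⁻¹ ≤ 1 / 2 := by
    rw [inv_eq_one_div]
    exact one_div_le_one_div_of_le (by norm_num) hB'
  have h2 := geom_sum_Ico_le_of_lt_one (m := m) (n := k) h0.le (by linarith)
  refine h2.trans ?_
  rw [div_le_iff₀ (by linarith)]
  nlinarith [pow_pos h0 m]

theorem sum_pow_range_succ_le {B : ℕ} (hB : 2 ≤ B) (m : ℕ) :
    ∑ j ∈ Finset.range (m + 1), (B : ℝ) ^ j ≤ 2 * (B : ℝ) ^ m := by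
  have hB' : (2 : ℝ) ≤ B := by exact_mod_cast hB
  induction m with
  | zero => simp
  | succ m ih =>
    rw [Finset.sum_range_succ]
    have : 0 < (B : ℝ) ^ m := by positivity
    rw [pow_succ]
    nlinarith

open Classical in
/-- The indicator that bidder `i` is served after item `B ^ (2 * j)` and no later than item
`B ^ (2 * (j + 1))`. -/
noncomputable def servedInPhase {n : ℕ} (M : DetMechanism n) (B j : ℕ) (v : Fin n → ℝ≥0)
    (i : Fin n) : ℝ :=
  if ∃ t, B ^ (2 * j) ≤ t ∧ t < B ^ (2 * (j + 1)) ∧ M.alloc v t = some i then 1 else 0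

/-- The welfare after `B ^ (2 * (j + 1))` items, split into the contributions of the low levels,
of the high levels, of the bidders served before the current phase, and of those served in it. -/
theorem welfare_levelProfile_le {n B K j : ℕ} (M : DetMechanism n) (hB : 2 ≤ B) (hj : j < K)
    (f : Fin n → Fin n) :
    (M.welfare (levelProfile B K f) (B ^ (2 * (j + 1))) : ℝ)
      ≤ 3 * (B : ℝ) ^ j
        + ∑ k ∈ Finset.range (j + 1), (B : ℝ)⁻¹ ^ k * countBelow f (B ^ (2 * k))
        + (B : ℝ)⁻¹ ^ (j + 1) * ∑ i, (if (f i : ℕ) < B ^ (2 * (j + 1)) then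
            servedInPhase M B j (levelProfile B K f) i else 0) := by
  have hB' : (2 : ℝ) ≤ B := by exact_mod_cast hB
  set b : ℝ := (B : ℝ)⁻¹ with hb
  have hb0 : 0 < b := by positivity
  set v := levelProfile B K f with hv
  set L : ℕ → ℕ := fun k => B ^ (2 * k) with hL
  -- Levels from j + 2 on form a geometric tail; level j + 1 is kept apart because only it has to be
  -- charged to the time of service.
  have hval : ∀ i, (v i : ℝ) ≤ 2 * b ^ (j + 2)
      + (∑ k ∈ Finset.range (j + 1), b ^ k * (if (f i : ℕ) < L k then 1 else 0))
      + b ^ (j + 1) * (if (f i : ℕ) < L (j + 1) then 1 else 0) := by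
    intro i
    have h1 : (v i : ℝ) = ∑ k ∈ Finset.range (K + 1), b ^ k * (if (f i : ℕ) < L k then 1 else 0) := by
      simp only [hv, levelProfile, levelValue, NNReal.coe_sum, mul_ite, mul_one, mul_zero]
      refine Finset.sum_congr rfl fun k _ => ?_
      split_ifs <;> simp_all
    rw [h1, ← Finset.sum_range_add_sum_Ico _ (show j + 2 ≤ K + 1 by omega),
      Finset.sum_range_succ _ (j + 1)]
    have h2 : ∑ k ∈ Finset.Ico (j + 2) (K + 1), b ^ k * (if (f i : ℕ) < L k then (1 : ℝ) else 0)
        ≤ 2 * b ^ (j + 2) := by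
      refine le_trans (Finset.sum_le_sum fun k _ => ?_) (sum_inv_pow_Ico_le hB (j + 2) (K + 1))
      split_ifs
      · rw [mul_one]
      · rw [mul_zero]
        positivity
    linarith
  have hcard : ∀ k, ((M.winners v (L k)).card : ℝ) ≤ (B : ℝ) ^ (2 * k) := fun k => by
    exact_mod_cast M.card_winners_le v (L k)
  have hphase : ∀ i ∈ M.winners v (L (j + 1)), (if (f i : ℕ) < L (j + 1) then (1 : ℝ) else 0)
      ≤ (if i ∈ M.winners v (L j) then 1 else 0)
        + (if (f i : ℕ) < L (j + 1) then servedInPhase M B j v i else 0) := by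
    intro i hi
    have hs : 0 ≤ servedInPhase M B j v i := by unfold servedInPhase; split_ifs <;> norm_num
    by_cases h1 : (f i : ℕ) < L (j + 1)
    · simp only [h1, if_true]
      by_cases h2 : i ∈ M.winners v (L j)
      · simp only [h2, if_true]; linarith
      · obtain ⟨t, ht, ha⟩ := DetMechanism.mem_winners.1 hi
        have h3 : servedInPhase M B j v i = 1 := by
          refine if_pos ⟨t, ?_, ht, ha⟩
          by_contra! h4
          exact h2 (DetMechanism.mem_winners.2 ⟨t, h4, ha⟩)
        simp [h2, h3]
    · simp only [h1, if_false]
      split_ifs <;> norm_num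
  have hsnn : ∀ i, 0 ≤ (if (f i : ℕ) < L (j + 1) then servedInPhase M B j v i else 0) := by
    intro i
    unfold servedInPhase
    split_ifs <;> norm_num
  have hlow : ∑ i ∈ M.winners v (L (j + 1)), 2 * b ^ (j + 2) ≤ 2 * (B : ℝ) ^ j := by
    rw [Finset.sum_const, nsmul_eq_mul]
    calc ((M.winners v (L (j + 1))).card : ℝ) * (2 * b ^ (j + 2))
        ≤ (B : ℝ) ^ (2 * (j + 1)) * (2 * b ^ (j + 2)) := by gcongr; exact hcard _
      _ = 2 * (B : ℝ) ^ j := by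
        rw [hb, show 2 * (j + 1) = j + (j + 2) by ring, pow_add, inv_pow]
        field_simp
  have hhigh : ∑ i ∈ M.winners v (L (j + 1)), (∑ k ∈ Finset.range (j + 1),
      b ^ k * (if (f i : ℕ) < L k then (1 : ℝ) else 0))
      ≤ ∑ k ∈ Finset.range (j + 1), b ^ k * countBelow f (L k) := by
    refine (Finset.sum_le_univ_sum_of_nonneg fun i =>
      Finset.sum_nonneg fun k _ => by split_ifs <;> positivity).trans ?_
    rw [Finset.sum_comm]
    simp only [countBelow, Finset.mul_sum]
    exact le_rfl
  -- At most B^(2j) bidders are served before the phase, too few to matter at level j + 1.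
  have hearly : b ^ (j + 1) * ∑ i ∈ M.winners v (L (j + 1)),
      (if i ∈ M.winners v (L j) then (1 : ℝ) else 0) ≤ (B : ℝ) ^ j := by
    have h1 : ∑ i ∈ M.winners v (L (j + 1)), (if i ∈ M.winners v (L j) then (1 : ℝ) else 0)
        ≤ (B : ℝ) ^ (2 * j) := by
      refine (Finset.sum_le_univ_sum_of_nonneg fun i => by split_ifs <;> norm_num).trans ?_
      simpa using hcard j
    calc _ ≤ b ^ (j + 1) * (B : ℝ) ^ (2 * j) := by gcongr
      _ ≤ b ^ j * (B : ℝ) ^ (2 * j) := by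
        gcongr 1
        refine pow_le_pow_of_le_one hb0.le ?_ (by omega)
        exact inv_le_one_of_one_le₀ (by linarith)
      _ = (B : ℝ) ^ j := by
        rw [hb, two_mul, pow_add, inv_pow]
        field_simp
  have hlate : b ^ (j + 1) * ∑ i ∈ M.winners v (L (j + 1)),
      (if (f i : ℕ) < L (j + 1) then servedInPhase M B j v i else 0)
      ≤ b ^ (j + 1) * ∑ i, (if (f i : ℕ) < L (j + 1) then servedInPhase M B j v i else 0) := by
    gcongr
    exacts [fun i _ _ => hsnn i, Finset.subset_univ _]
  calc (M.welfare v (L (j + 1)) : ℝ) = ∑ i ∈ M.winners v (L (j + 1)), (v i : ℝ) := by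
        simp [DetMechanism.welfare]
    _ ≤ ∑ i ∈ M.winners v (L (j + 1)), (2 * b ^ (j + 2)
        + (∑ k ∈ Finset.range (j + 1), b ^ k * (if (f i : ℕ) < L k then 1 else 0))
        + b ^ (j + 1) * ((if i ∈ M.winners v (L j) then 1 else 0)
          + (if (f i : ℕ) < L (j + 1) then servedInPhase M B j v i else 0))) := by
        refine Finset.sum_le_sum fun i hi => (hval i).trans ?_
        gcongr
        exact hphase i hi
    _ ≤ _ := by
        rw [Finset.sum_add_distrib, Finset.sum_add_distrib,
          ← Finset.mul_sum _ _ (b ^ (j + 1)), Finset.sum_add_distrib, mul_add]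
        linarith

/-- The weight is the reciprocal of the number of types below B^(2(j+1)), so each phase contributes
at most 1. Varying only the type of i, at most three phases can contain a service time of i. -/
theorem DetMechanism.Truthful.sum_servedInPhase_le {n B K : ℕ} {M : DetMechanism n}
    (hM : M.Truthful) (hB : 2 ≤ B) (hn : B ^ (2 * K) ≤ n) (f : Fin n → Fin n) (i : Fin n) :
    ∑ r : Fin n, ∑ j ∈ Finset.range K, (B : ℝ)⁻¹ ^ (2 * (j + 1)) *
      (if (r : ℕ) < B ^ (2 * (j + 1)) then
        servedInPhase M B j (levelProfile B K (Function.update f i r)) i else 0) ≤ 3 := by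
  classical
  have hB' : (2 : ℝ) ≤ B := by exact_mod_cast hB
  set E : ℕ → Prop := fun j => ∃ r : Fin n, ∃ t, B ^ (2 * j) ≤ t ∧ t < B ^ (2 * (j + 1)) ∧
    M.alloc (Function.update (levelProfile B K f) i (levelValue B K r)) t = some i with hE
  have h1 : ((Finset.range K).filter E).card ≤ 3 := by
    obtain ⟨c, hc⟩ := hM.exists_sign i (levelProfile B K f)
    have h : ∀ j ∈ (Finset.range K).filter E, E j := fun j hj => (Finset.mem_filter.1 hj).2
    have : Nonempty (Fin n) := ⟨i⟩
    choose! r t ht1 ht2 ht3 using h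
    have := Finset.card_le_card_of_injOn (s := (Finset.range K).filter E)
      (t := (Finset.univ : Finset SignType)) (fun j => c (levelValue B K (r j)))
      -- Equal signs give equal service times, and the phases are disjoint, so j = k.
      (fun _ _ => by simp) (fun j hj k hk hjk => by
        have hjk' := hc _ _ _ _ (ht3 j hj) (ht3 k hk) hjk
        have h1 := ht1 j hj
        have h2 := ht2 j hj
        have h3 := ht1 k hk
        have h4 := ht2 k hk
        rw [hjk'] at h1 h2
        have h5 := (Nat.pow_lt_pow_iff_right (show 1 < B by omega)).1 (h1.trans_lt h4)
        have h6 := (Nat.pow_lt_pow_iff_right (show 1 < B by omega)).1 (h3.trans_lt h2)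
        omega)
    exact this
  rw [Finset.sum_comm]
  have h2 : ∀ j ∈ Finset.range K, ∑ r : Fin n, (B : ℝ)⁻¹ ^ (2 * (j + 1)) *
      (if (r : ℕ) < B ^ (2 * (j + 1)) then
        servedInPhase M B j (levelProfile B K (Function.update f i r)) i else 0)
      ≤ if E j then 1 else 0 := by
    intro j hj
    have hjK : B ^ (2 * (j + 1)) ≤ n := by
      refine le_trans (Nat.pow_le_pow_right (by omega) ?_) hn
      have := Finset.mem_range.1 hj
      omega
    rw [← Finset.mul_sum]
    split_ifs with hEj
    · have h3 : ∑ r : Fin n, (if (r : ℕ) < B ^ (2 * (j + 1)) then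
          servedInPhase M B j (levelProfile B K (Function.update f i r)) i else 0)
          ≤ ∑ r : Fin n, if (r : ℕ) < B ^ (2 * (j + 1)) then (1 : ℝ) else 0 := by
        refine Finset.sum_le_sum fun r _ => ?_
        unfold servedInPhase
        split_ifs <;> norm_num
      rw [sum_ite_val_lt hjK] at h3
      calc _ ≤ (B : ℝ)⁻¹ ^ (2 * (j + 1)) * ((B ^ (2 * (j + 1)) : ℕ) : ℝ) := by gcongr
        _ = 1 := by
          push_cast
          rw [inv_pow]
          exact inv_mul_cancel₀ (by positivity)
    · rw [Finset.sum_eq_zero, mul_zero]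
      intro r _
      rw [levelProfile_update]
      have : servedInPhase M B j
          (Function.update (levelProfile B K f) i (levelValue B K r)) i = 0 :=
        if_neg fun ⟨t, ht⟩ => hEj ⟨r, t, ht⟩
      simp [this]
  refine (Finset.sum_le_sum h2).trans ?_
  rw [Finset.sum_boole]
  exact_mod_cast h1

/-- The welfare of a truthful mechanism averaged over all type profiles, summed over the supplies
`B ^ (2 * (j + 1))` with weights inverse to the optimum. -/
theorem DetMechanism.Truthful.sum_sum_welfare_le {n B K : ℕ} {M : DetMechanism n}
    (hM : M.Truthful) (hB : 2 ≤ B) (hKB : K ≤ B) (hn : B ^ (2 * K) ≤ n) :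
    ∑ j ∈ Finset.range K, ∑ f : Fin n → Fin n, (B : ℝ)⁻¹ ^ (j + 1) *
      (M.welfare (levelProfile B K f) (B ^ (2 * (j + 1))) : ℝ)
      ≤ 8 * Fintype.card (Fin n → Fin n) := by
  have hB' : (2 : ℝ) ≤ B := by exact_mod_cast hB
  have hn0 : 0 < n := lt_of_lt_of_le (by positivity) hn
  have hn0' : (0 : ℝ) < n := by exact_mod_cast hn0
  set C : ℝ := ((Fintype.card (Fin n → Fin n) : ℕ) : ℝ) with hC
  have hC0 : 0 ≤ C := by positivity
  set b : ℝ := (B : ℝ)⁻¹ with hb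
  have hb0 : 0 < b := by positivity
  set D : ℕ → (Fin n → Fin n) → Fin n → ℝ := fun j f i =>
    if (f i : ℕ) < B ^ (2 * (j + 1)) then servedInPhase M B j (levelProfile B K f) i else 0
    with hD
  have h1 : ∀ j ∈ Finset.range K, ∑ f : Fin n → Fin n, b ^ (j + 1) *
      (M.welfare (levelProfile B K f) (B ^ (2 * (j + 1))) : ℝ)
      ≤ 5 * C * b + ∑ f : Fin n → Fin n, ∑ i, b ^ (2 * (j + 1)) * D j f i := by
    intro j hj
    have hjK := Finset.mem_range.1 hj
    have h2 : ∑ f : Fin n → Fin n, ∑ k ∈ Finset.range (j + 1),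
        b ^ k * countBelow f (B ^ (2 * k)) ≤ C * (2 * (B : ℝ) ^ j) := by
      rw [Finset.sum_comm]
      refine le_trans (le_of_eq ?_)
        (mul_le_mul_of_nonneg_left (sum_pow_range_succ_le hB j) hC0)
      rw [Finset.mul_sum]
      refine Finset.sum_congr rfl fun k hk => ?_
      have hk' := Finset.mem_range.1 hk
      rw [← Finset.mul_sum, sum_countBelow hn0
        (le_trans (Nat.pow_le_pow_right (by omega) (by omega)) hn), ← hC]
      push_cast
      rw [hb, two_mul, pow_add, inv_pow]
      field_simp
    calc ∑ f : Fin n → Fin n, b ^ (j + 1) *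
          (M.welfare (levelProfile B K f) (B ^ (2 * (j + 1))) : ℝ)
        ≤ ∑ f : Fin n → Fin n, b ^ (j + 1) * (3 * (B : ℝ) ^ j
          + ∑ k ∈ Finset.range (j + 1), b ^ k * countBelow f (B ^ (2 * k))
          + b ^ (j + 1) * ∑ i, D j f i) :=
          Finset.sum_le_sum fun f _ => by
            gcongr
            exact welfare_levelProfile_le M hB hjK f
      _ = b ^ (j + 1) * (3 * (B : ℝ) ^ j * C + ∑ f : Fin n → Fin n,
            ∑ k ∈ Finset.range (j + 1), b ^ k * countBelow f (B ^ (2 * k)))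
          + ∑ f : Fin n → Fin n, ∑ i, b ^ (2 * (j + 1)) * D j f i := by
          simp only [mul_add, Finset.sum_add_distrib, ← Finset.mul_sum, Finset.sum_const,
            Finset.card_univ, nsmul_eq_mul, ← hC]
          ring
      _ ≤ b ^ (j + 1) * (3 * (B : ℝ) ^ j * C + C * (2 * (B : ℝ) ^ j))
          + ∑ f : Fin n → Fin n, ∑ i, b ^ (2 * (j + 1)) * D j f i := by gcongr
      _ = _ := by
          congr 1
          have : b ^ j * (B : ℝ) ^ j = 1 := by
            rw [← mul_pow, hb, inv_mul_cancel₀ (by positivity), one_pow]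
          rw [pow_succ]
          linear_combination (5 * C * b) * this
  have h3 : ∑ j ∈ Finset.range K, ∑ f : Fin n → Fin n, ∑ i, b ^ (2 * (j + 1)) * D j f i
      ≤ 3 * C := by
    -- Resampling the type of i alone reduces the average to the bound with the other types fixed.
    have h4 : ∀ i : Fin n, n * ∑ f : Fin n → Fin n,
        ∑ j ∈ Finset.range K, b ^ (2 * (j + 1)) * D j f i ≤ C * 3 := by
      intro i
      have := sum_sum_update (fun f : Fin n → Fin n =>
        ∑ j ∈ Finset.range K, b ^ (2 * (j + 1)) * D j f i) i
      rw [Fintype.card_fin] at this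
      rw [← this]
      refine (Finset.sum_le_sum fun f _ => ?_).trans
        (le_of_eq (Finset.sum_const (3 : ℝ)) |>.trans (by simp [hC]))
      simpa only [hD, Function.update_self] using hM.sum_servedInPhase_le hB hn f i
    have h5 : ∑ j ∈ Finset.range K, ∑ f : Fin n → Fin n, ∑ i, b ^ (2 * (j + 1)) * D j f i
        = ∑ i, ∑ f : Fin n → Fin n, ∑ j ∈ Finset.range K, b ^ (2 * (j + 1)) * D j f i := by
      rw [Finset.sum_comm, Finset.sum_comm (s := (Finset.univ : Finset (Fin n)))]
      exact Finset.sum_congr rfl fun f _ => Finset.sum_comm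
    rw [h5]
    calc _ ≤ ∑ _i : Fin n, C * 3 / n := Finset.sum_le_sum fun i _ => by
          rw [le_div_iff₀ hn0', mul_comm]
          exact h4 i
      _ = 3 * C := by
          rw [Finset.sum_const, Finset.card_univ, Fintype.card_fin, nsmul_eq_mul]
          field_simp
  refine (Finset.sum_le_sum h1).trans ?_
  rw [Finset.sum_add_distrib, Finset.sum_const, Finset.card_range, nsmul_eq_mul]
  -- The loss of 5/B per phase totals at most 5 over K ≤ B phases; together with 3 this gives 8.
  have h6 : (K : ℝ) * b ≤ 1 := by
    rw [hb, ← div_eq_mul_inv, div_le_one (by positivity)]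
    exact_mod_cast hKB
  nlinarith

/-! ### Comparison with the optimum and the choice of K. -/

theorem card_mul_half_le_sum_optWelfare {n B K j : ℕ} (hB : 2 ≤ B) (hn : B ^ (2 * K) ≤ n)
    (hj : j ≤ K) :
    Fintype.card (Fin n → Fin n) * (1 / 2 : ℝ) ≤ ∑ f : Fin n → Fin n, (B : ℝ)⁻¹ ^ j *
      (optWelfare (levelProfile B K f) (B ^ (2 * j)) : ℝ) := by
  have hB' : (2 : ℝ) ≤ B := by exact_mod_cast hB
  have hn0 : 0 < n := lt_of_lt_of_le (by positivity) hn
  have hjn : B ^ (2 * j) ≤ n := le_trans (Nat.pow_le_pow_right (by omega) (by omega)) hn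
  have h1 := card_mul_half_le_sum_min_countBelow hn0 hjn (by positivity)
  have h2 : ∀ f : Fin n → Fin n, (B : ℝ)⁻¹ ^ j * min (countBelow f (B ^ (2 * j))) (B ^ (2 * j) : ℕ)
      ≤ (optWelfare (levelProfile B K f) (B ^ (2 * j)) : ℝ) := by
    intro f
    have h3 := mul_min_card_le_optWelfare (levelProfile B K f) (B ^ (2 * j)) ((B : ℝ≥0)⁻¹ ^ j)
      (Finset.univ.filter fun i => (f i : ℕ) < B ^ (2 * j)) (fun i hi => by
        have hi' : (f i : ℕ) < B ^ (2 * j) := (Finset.mem_filter.1 hi).2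
        have := Finset.single_le_sum (s := Finset.range (K + 1))
          (f := fun k => if (f i : ℕ) < B ^ (2 * k) then (B : ℝ≥0)⁻¹ ^ k else 0)
          (fun _ _ => zero_le) (Finset.mem_range.2 (show j < K + 1 by omega))
        simpa only [hi', if_true, levelProfile, levelValue] using this)
    have h4 := NNReal.coe_le_coe.2 h3
    rw [countBelow, Finset.sum_boole]
    push_cast at h4 ⊢
    exact h4
  have hpow : (B : ℝ)⁻¹ ^ j * (B : ℝ)⁻¹ ^ j * (B : ℝ) ^ (2 * j) = 1 := by
    rw [← pow_add, ← two_mul, ← mul_pow, inv_mul_cancel₀ (by positivity), one_pow]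
  calc (Fintype.card (Fin n → Fin n) : ℝ) * (1 / 2)
      = (B : ℝ)⁻¹ ^ j * (B : ℝ)⁻¹ ^ j *
        (Fintype.card (Fin n → Fin n) * (((B ^ (2 * j) : ℕ) : ℝ) / 2)) := by
        push_cast
        linear_combination (-(Fintype.card (Fin n → Fin n) : ℝ) / 2) * hpow
    _ ≤ (B : ℝ)⁻¹ ^ j * (B : ℝ)⁻¹ ^ j *
        ∑ f : Fin n → Fin n, min (countBelow f (B ^ (2 * j))) (B ^ (2 * j) : ℕ) := by gcongr
    _ ≤ _ := by
        rw [mul_assoc, Finset.mul_sum, Finset.mul_sum]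
        exact Finset.sum_le_sum fun f _ => by
          gcongr
          exact h2 f

/-- A truthful randomized mechanism for `n ≥ K ^ (2 * K)` bidders has approximation factor at least
`K / 16`. -/
theorem RandMechanism.Truthful.le_of_achievesApprox {n K : ℕ} {M : RandMechanism.{u} n}
    (hM : M.Truthful) (hK : 2 ≤ K) (hn : K ^ (2 * K) ≤ n) {α : ℝ} (hα : M.AchievesApprox α) :
    (K : ℝ) / 16 ≤ α := by
  have hK' : (2 : ℝ) ≤ K := by exact_mod_cast hK
  have hn0 : 0 < n := lt_of_lt_of_le (by positivity) hn
  have : Nonempty (Fin n) := ⟨⟨0, hn0⟩⟩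
  set C : ℝ := ((Fintype.card (Fin n → Fin n) : ℕ) : ℝ) with hC
  have hC0 : 0 < C := by
    rw [hC]
    exact_mod_cast Fintype.card_pos
  set S : ℝ := ∑ j ∈ Finset.range K, ∑ f : Fin n → Fin n, (K : ℝ)⁻¹ ^ (j + 1) *
      M.expectedWelfare (levelProfile K K f) (K ^ (2 * (j + 1))) with hS
  have hS0 : 0 ≤ S := Finset.sum_nonneg fun j _ => Finset.sum_nonneg fun f _ =>
    mul_nonneg (by positivity) (MeasureTheory.integral_nonneg fun ω => NNReal.coe_nonneg _)
  have hS8 : S ≤ 8 * C := by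
    have h1 : S = ∫ ω, ∑ j ∈ Finset.range K, ∑ f : Fin n → Fin n, (K : ℝ)⁻¹ ^ (j + 1) *
        ((M.mech ω).welfare (levelProfile K K f) (K ^ (2 * (j + 1))) : ℝ) ∂M.P := by
      have hi : ∀ (j : ℕ) (f : Fin n → Fin n), MeasureTheory.Integrable (fun ω =>
          (K : ℝ)⁻¹ ^ (j + 1) *
          ((M.mech ω).welfare (levelProfile K K f) (K ^ (2 * (j + 1))) : ℝ)) M.P :=
        fun j f => (M.integrable_welfare _ _).const_mul _
      rw [MeasureTheory.integral_finsetSum _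
        fun j _ => MeasureTheory.integrable_finsetSum _ fun f _ => hi j f]
      refine Finset.sum_congr rfl fun j _ => ?_
      rw [MeasureTheory.integral_finsetSum _ fun f _ => hi j f]
      refine Finset.sum_congr rfl fun f _ => ?_
      rw [MeasureTheory.integral_const_mul]
      rfl
    rw [h1]
    have h2 : ∫ _ω, 8 * C ∂M.P = 8 * C := by simp
    rw [← h2]
    refine MeasureTheory.integral_mono_of_nonneg
      (Filter.Eventually.of_forall fun ω => ?_) (MeasureTheory.integrable_const _)
      (Filter.Eventually.of_forall fun ω => (hM ω).sum_sum_welfare_le hK le_rfl hn)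
    exact Finset.sum_nonneg fun j _ => Finset.sum_nonneg fun f _ => by positivity
  have hlow : K * (C * (1 / 2)) ≤ α * S := by
    have h1 : ∀ j ∈ Finset.range K, C * (1 / 2) ≤ α * ∑ f : Fin n → Fin n, (K : ℝ)⁻¹ ^ (j + 1) *
        M.expectedWelfare (levelProfile K K f) (K ^ (2 * (j + 1))) := by
      intro j hj
      have hj' := Finset.mem_range.1 hj
      refine (card_mul_half_le_sum_optWelfare hK hn (show j + 1 ≤ K by omega)).trans ?_
      rw [Finset.mul_sum]
      refine Finset.sum_le_sum fun f _ => ?_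
      rw [mul_left_comm]
      gcongr
      exact hα _ _ (Nat.one_le_pow _ _ (by omega))
        (le_trans (Nat.pow_le_pow_right (by omega) (by omega)) hn)
    have h2 := Finset.sum_le_sum h1
    rw [← Finset.mul_sum _ _ α, Finset.sum_const, Finset.card_range, nsmul_eq_mul] at h2
    exact h2
  -- The sign of α must be known before S is replaced by its upper bound.
  have hα0 : 0 < α := by
    by_contra! h
    have : 0 < K * (C * (1 / 2)) := by positivity
    nlinarith [mul_nonneg (neg_nonneg.2 h) hS0]
  have h3 : K * (C * (1 / 2)) ≤ α * (8 * C) := hlow.trans (by gcongr)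
  have h4 : (K : ℝ) / 2 ≤ 8 * α := le_of_mul_le_mul_right (by linarith) hC0
  linarith

/-- If `y = log log n ≥ 12` and `K = ⌊y⌋`, then `K ^ (2 * K) ≤ n`. -/
theorem floor_log_log_pow_le {n : ℕ} (hy : 12 ≤ Real.log (Real.log n)) :
    ⌊Real.log (Real.log n)⌋₊ ^ (2 * ⌊Real.log (Real.log n)⌋₊) ≤ n := by
  set y := Real.log (Real.log n) with hy'
  set K := ⌊y⌋₊ with hK
  have hKy : (K : ℝ) ≤ y := Nat.floor_le (by linarith)
  have hK0 : 0 < K := Nat.floor_pos.2 (by linarith)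
  have hlog : 0 < Real.log n := by
    by_contra! h
    have h0 : 0 ≤ Real.log (n : ℝ) := Real.log_natCast_nonneg n
    rw [hy', le_antisymm h h0, Real.log_zero] at hy
    linarith
  have hn0 : (0 : ℝ) < n := by
    rcases Nat.eq_zero_or_pos n with h | h
    · simp [h] at hlog
    · exact_mod_cast h
  have h1 : 2 * y ^ 2 ≤ Real.log n := by
    rw [← Real.exp_log hlog, ← hy']
    -- The threshold 12 is where y³/6 ≥ 2y².
    have := Real.pow_div_factorial_le_exp y (by linarith) 3
    norm_num [Nat.factorial] at this
    nlinarith [sq_nonneg y]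
  have h2 : Real.log K ≤ y :=
    (Real.log_le_self (Nat.cast_nonneg K)).trans hKy
  have h3 : ((K : ℝ) ^ (2 * K)) ≤ n := by
    rw [← Real.log_le_log_iff (by positivity) hn0, Real.log_pow]
    refine le_trans ?_ h1
    push_cast
    have : (K : ℝ) * Real.log K ≤ y * y := by
      have := Real.log_natCast_nonneg K
      gcongr
    nlinarith
  exact_mod_cast h3

theorem exists_log_log_le_of_achievesApprox :
    ∃ c : ℝ, 0 < c ∧ ∃ N : ℕ, ∀ n : ℕ, N ≤ n →
      ∀ M : RandMechanism.{u} n, M.Truthful →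
        ∀ α : ℝ, M.AchievesApprox α → c * Real.log (Real.log n) ≤ α := by
  -- With y = log log n ≥ 12, ⌊y⌋ > y - 1 ≥ y/2, so ⌊y⌋/16 ≥ y/32.
  refine ⟨1 / 32, by norm_num, ⌈Real.exp (Real.exp 12)⌉₊, fun n hn M hM α hα => ?_⟩
  have hn' : Real.exp (Real.exp 12) ≤ n := (Nat.le_ceil _).trans (by exact_mod_cast hn)
  have h1 : Real.exp 12 ≤ Real.log n := by
    rw [Real.le_log_iff_exp_le (lt_of_lt_of_le (Real.exp_pos _) hn')]
    exact hn'
  have h2 : 12 ≤ Real.log (Real.log n) := by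
    rw [Real.le_log_iff_exp_le (lt_of_lt_of_le (Real.exp_pos _) h1)]
    exact h1
  have h3 := hM.le_of_achievesApprox (Nat.le_floor (by norm_num; linarith))
    (floor_log_log_pow_le h2) hα
  have h4 := Nat.sub_one_lt_floor (Real.log (Real.log n))
  linarith

end OnlineSupply

theorem tendsto_log_log_natCast_atTop :
    Filter.Tendsto (fun n : ℕ => Real.log (Real.log n)) Filter.atTop Filter.atTop :=
  Real.tendsto_log_atTop.comp (Real.tendsto_log_atTop.comp tendsto_natCast_atTop_atTop)

/-- No truthful randomized mechanism achieves an `o(log log n)` approximation to social welfare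
with adversarial supply: every approximation factor is at least `c * log log n` with a universal
constant `c > 0` for all large `n`, and hence no family of truthful mechanisms has, even for just
infinitely many `n`, approximation factors `α n` for a function `α` in `o(log log n)`. -/
theorem theorem2 :
    (∃ c : ℝ, 0 < c ∧ ∃ N : ℕ, ∀ n : ℕ, N ≤ n →
      ∀ M : OnlineSupply.RandMechanism.{u} n, M.Truthful →
        ∀ α : ℝ, M.AchievesApprox α → c * Real.log (Real.log n) ≤ α) ∧
    (∀ (M : (n : ℕ) → OnlineSupply.RandMechanism.{u} n) (α : ℕ → ℝ),
      (∀ n, (M n).Truthful) →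
      (∃ᶠ n in Filter.atTop, (M n).AchievesApprox (α n)) →
        ¬ α =o[Filter.atTop] fun n : ℕ => Real.log (Real.log n)) := by
  refine ⟨OnlineSupply.exists_log_log_le_of_achievesApprox, fun M α hM hfreq ho => ?_⟩
  obtain ⟨c, hc, N, hN⟩ := OnlineSupply.exists_log_log_le_of_achievesApprox.{u}
  -- Half of c suffices to contradict the lower bound at a single large n with log log n > 0.
  have h1 := ho.bound (half_pos hc)
  have h2 := tendsto_log_log_natCast_atTop.eventually_gt_atTop 0
  obtain ⟨n, hn, hb, hpos, hNn⟩ :=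
    (hfreq.and_eventually (h1.and (h2.and (Filter.eventually_ge_atTop N)))).exists
  have h3 := hN n hNn (M n) (hM n) (α n) hn
  rw [Real.norm_of_nonneg hpos.le] at hb
  have h4 := (le_abs_self (α n)).trans hb
  nlinarith
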